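/- Let $W(2,2)$ be the complex Lie algebra with basis $\{L_m, H_m, c \mid m\in\mathbb{Z}\}$ and Lie brackets $$[L_m,L_n]=(m-n)L_{m+n}+\frac{m^3-m}{12}\,\delta_{m+n,0}\,c,\qquad [L_m,H_n]=(m-n)H_{m+n}+\frac{m^3-m}{12}\,\delta_{m+n,0}\,c,$$ $$[H_m,H_n]=0,\qquad [x,c]=0\ \text{ for all } x\in W(2,2).$$ Let $\omega: W(2,2)\to W(2,2)$ be the linear map determined by $\omega(L_m)=H_m$ and $\omega(H_m)=\omega(c)=0$ for all $m\in\mathbb{Z}$. A bilinear map $f: W(2,2)\times W(2,2)\to W(2,2)$ is called a biderivation if $$f([x,y],z)=[x,f(y,z)]+[f(x,z),y]\quad\text{and}\quad f(x,[y,z])=[f(x,y),z]+[y,f(x,z)]$$ for all $x,y,z\in W(2,2)$ (no skew-symmetry is assumed), and inner if there is $\lambda\in\mathbb{C}$ with $f(x,y)=\lambda[x,y]$ for all $x,y$. Then a bilinear map $f: W(2,2)\times W(2,2)\to W(2,2)$ is a biderivation if and only if there are $\lambda,\mu\in\mathbb{C}$ such that $$f(x,y)=\lambda[x,y]+\mu[\omega(x),y]\qquad\text{for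 all } x,y\in W(2,2).$$ Moreover, there exists a biderivation of $W(2,2)$ that is not inner. -/

import Mathlib

/-- A bilinear map `f : L × L → L` on a Lie algebra is a biderivation if it is a derivation in
each of its two arguments. No skew-symmetry is required. -/
def IsBiderivation {L : Type*} [LieRing L] [LieAlgebra ℂ L] (f : L →ₗ[ℂ] L →ₗ[ℂ] L) : Prop :=
  (∀ x y z : L, f ⁅x, y⁆ z = ⁅x, f y z⁆ + ⁅f x z, y⁆) ∧
  (∀ x y z : L, f x ⁅y, z⁆ = ⁅f x y, z⁆ + ⁅y, f x z⁆)

/-- A bilinear map is inner if it is a scalar multiple of the Lie bracket. -/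
def IsInnerBiderivation {L : Type*} [LieRing L] [LieAlgebra ℂ L]
    (f : L →ₗ[ℂ] L →ₗ[ℂ] L) : Prop :=
  ∃ a : ℂ, ∀ x y : L, f x y = a • ⁅x, y⁆

/-- Labels of the basis `{L_m, H_m, c | m ∈ ℤ}` of `W(2,2)`. -/
inductive W22Index : Type
  | L : ℤ → W22Index
  | H : ℤ → W22Index
  | c : W22Index

/-- The complex vector space with basis `{L_m, H_m, c | m ∈ ℤ}` underlying `W(2,2)`. -/
def W22 : Type := W22Index →₀ ℂ

namespace W22

noncomputable instance : AddCommGroup W22 := inferInstanceAs (AddCommGroup (W22Index →₀ ℂ))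

noncomputable instance : Module ℂ W22 := inferInstanceAs (Module ℂ (W22Index →₀ ℂ))

/-- The basis of `W(2,2)`. -/
noncomputable def basis : Module.Basis W22Index ℂ W22 :=
  Module.Basis.ofRepr (LinearEquiv.refl ℂ (W22Index →₀ ℂ))

/-- The basis vector `L_m`. -/
noncomputable def L (m : ℤ) : W22 := basis (W22Index.L m)

/-- The basis vector `H_m`. -/
noncomputable def H (m : ℤ) : W22 := basis (W22Index.H m)

/-- The basis vector `c`. -/
noncomputable def c : W22 := basis W22Index.c

/-- The scalar `(m³ - m) / 12 · δ_{m+n,0}`. -/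
noncomputable def cocycle (m n : ℤ) : ℂ :=
  if m + n = 0 then ((m : ℂ) ^ 3 - (m : ℂ)) / 12 else 0

/-- The Lie bracket of two basis vectors. -/
noncomputable def bracketBasis : W22Index → W22Index → W22
  | .L m, .L n => ((m : ℂ) - (n : ℂ)) • L (m + n) + cocycle m n • c
  | .L m, .H n => ((m : ℂ) - (n : ℂ)) • H (m + n) + cocycle m n • c
  | .H m, .L n => -(((n : ℂ) - (m : ℂ)) • H (n + m) + cocycle n m • c)
  | .H _, .H _ => 0
  | .c, _ => 0
  | _, .c => 0

/-- The Lie bracket of `W(2,2)`, extended bilinearly from the basis. -/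
noncomputable def bracket : W22 →ₗ[ℂ] W22 →ₗ[ℂ] W22 :=
  basis.constr ℂ fun i => basis.constr ℂ fun j => bracketBasis i j

theorem bracket_basis (i j : W22Index) : bracket (basis i) (basis j) = bracketBasis i j := by
  simp [bracket, Module.Basis.constr_basis]

theorem cocycle_swap (m n : ℤ) : cocycle n m = -cocycle m n := by
  unfold cocycle
  by_cases h : m + n = 0
  · have h2 : n = -m := by omega
    subst h2
    simp
    ring
  · have h2 : ¬ n + m = 0 := by omega
    simp [h, h2]

theorem bracketBasis_swap (i j : W22Index) : bracketBasis j i = -bracketBasis i j := by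
  rcases i with m | m | _ <;> rcases j with n | n | _ <;>
    simp only [bracketBasis, neg_neg, neg_zero]
  rw [cocycle_swap m n, add_comm n m]
  module

theorem bracket_swap (x y : W22) : bracket y x = -bracket x y := by
  have h : bracket.flip = -bracket := by
    refine basis.ext fun i => basis.ext fun j => ?_
    simp only [LinearMap.flip_apply, LinearMap.neg_apply, bracket_basis]
    exact bracketBasis_swap i j
  have := LinearMap.congr_fun (LinearMap.congr_fun h x) y
  simpa using this

theorem cocycle_jacobi (m n k : ℤ) :
    ((n : ℂ) - k) * cocycle m (n + k) =
      ((m : ℂ) - n) * cocycle (m + n) k + ((m : ℂ) - k) * cocycle n (m + k) := by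
  unfold cocycle
  by_cases h : m + n + k = 0
  · have h1 : m + (n + k) = 0 := by omega
    have h2 : n + (m + k) = 0 := by omega
    have h3 : k = -(m + n) := by omega
    rw [if_pos h, if_pos h1, if_pos h2, h3]
    push_cast
    ring
  · have h1 : ¬ m + (n + k) = 0 := by omega
    have h2 : ¬ n + (m + k) = 0 := by omega
    rw [if_neg h, if_neg h1, if_neg h2]
    simp

theorem bracket_jacobi_aux (v : ℤ → W22) (w : W22) (m n k : ℤ) :
    ((n : ℂ) - k) • (((m : ℂ) - ((n + k : ℤ) : ℂ)) • v (m + (n + k)) + cocycle m (n + k) • w) =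
      ((m : ℂ) - n) • ((((m + n : ℤ) : ℂ) - k) • v (m + n + k) + cocycle (m + n) k • w) +
        ((m : ℂ) - k) • (((n : ℂ) - ((m + k : ℤ) : ℂ)) • v (n + (m + k)) +
          cocycle n (m + k) • w) := by
  have h1 : m + n + k = m + (n + k) := by omega
  have h2 : n + (m + k) = m + (n + k) := by omega
  have h3 := congrArg (fun t : ℂ => t • w) (cocycle_jacobi m n k)
  simp only [add_smul, mul_smul] at h3
  rw [h1, h2, smul_add, smul_add, smul_add, h3]
  push_cast
  module

theorem bracket_jacobi_basis (i j k : W22Index) :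
    bracket (basis i) (bracket (basis j) (basis k)) =
      bracket (bracket (basis i) (basis j)) (basis k) +
        bracket (basis j) (bracket (basis i) (basis k)) := by
  rcases i with m | m | _ <;> rcases j with n | n | _ <;> rcases k with k | k | _ <;>
    simp only [bracket_basis, bracketBasis, L, H, c, map_add, map_neg, map_smul, map_zero,
      LinearMap.add_apply, LinearMap.neg_apply, LinearMap.smul_apply, LinearMap.zero_apply,
      smul_zero, add_zero, neg_zero]
  · exact bracket_jacobi_aux (fun t => basis (.L t)) _ m n k
  · exact bracket_jacobi_aux (fun t => basis (.H t)) _ m n k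
  · have h := bracket_jacobi_aux (fun t => basis (.H t)) (basis .c) m k n
    beta_reduce at h
    rw [smul_neg, smul_neg, ← neg_add, h, add_comm]
  · have h := bracket_jacobi_aux (fun t => basis (.H t)) (basis .c) n k m
    beta_reduce at h
    rw [smul_neg, smul_neg, neg_neg, h]
    abel

theorem bracket_jacobi (x y z : W22) :
    bracket x (bracket y z) = bracket (bracket x y) z + bracket y (bracket x z) := by
  have hz : ∀ i j, bracket (basis i) ∘ₗ bracket (basis j) =
      bracket (bracket (basis i) (basis j)) + bracket (basis j) ∘ₗ bracket (basis i) := fun i j =>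
    basis.ext fun k => bracket_jacobi_basis i j k
  have hy : ∀ i, ((bracket.flip z).comp (bracket (basis i))) =
      bracket (basis i) ∘ₗ bracket.flip z - bracket.flip (bracket (basis i) z) := fun i =>
    basis.ext fun j => by
      have := LinearMap.congr_fun (hz i j) z
      simp only [LinearMap.comp_apply, LinearMap.add_apply, LinearMap.sub_apply,
        LinearMap.flip_apply] at this ⊢
      rw [this]
      abel
  have hx : bracket.flip (bracket y z) =
      bracket.flip z ∘ₗ bracket.flip y + bracket y ∘ₗ bracket.flip z := basis.ext fun i => by
    have := LinearMap.congr_fun (hy i) y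
    simp only [LinearMap.comp_apply, LinearMap.add_apply, LinearMap.sub_apply,
      LinearMap.flip_apply] at this ⊢
    rw [this]
    abel
  exact LinearMap.congr_fun hx x

noncomputable instance : LieRing W22 where
  bracket x y := bracket x y
  add_lie x y z := by simp only [map_add, LinearMap.add_apply]
  lie_add x y z := by simp only [map_add]
  lie_self x := by
    have h : bracket x x = -bracket x x := bracket_swap x x
    have h2 : (2 : ℂ) • bracket x x = 0 := by rw [two_smul]; exact add_eq_zero_iff_eq_neg.mpr h
    exact (smul_eq_zero.mp h2).resolve_left two_ne_zero
  leibniz_lie x y z := bracket_jacobi x y z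

noncomputable instance : LieAlgebra ℂ W22 where
  lie_smul a x y := (bracket x).map_smul a y

theorem lie_L_L (m n : ℤ) : ⁅L m, L n⁆ =
    ((m : ℂ) - n) • L (m + n) + (if m + n = 0 then ((m : ℂ) ^ 3 - m) / 12 else 0) • c :=
  bracket_basis _ _

theorem lie_L_H (m n : ℤ) : ⁅L m, H n⁆ =
    ((m : ℂ) - n) • H (m + n) + (if m + n = 0 then ((m : ℂ) ^ 3 - m) / 12 else 0) • c :=
  bracket_basis _ _

theorem lie_H_H (m n : ℤ) : ⁅H m, H n⁆ = 0 :=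
  bracket_basis _ _

theorem lie_c (x : W22) : ⁅x, c⁆ = 0 := by
  have h : bracket.flip c = 0 := by
    refine basis.ext fun i => ?_
    rw [LinearMap.flip_apply, c, bracket_basis]
    cases i <;> rfl
  exact LinearMap.congr_fun h x

/-- The linear map `ω` with `ω(L_m) = H_m` and `ω(H_m) = ω(c) = 0`. -/
noncomputable def omega : W22 →ₗ[ℂ] W22 :=
  basis.constr ℂ fun i => match i with
    | .L m => H m
    | .H _ => 0
    | .c => 0

theorem omega_L (m : ℤ) : omega (L m) = H m := by
  simp [omega, L, Module.Basis.constr_basis]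

theorem omega_H (m : ℤ) : omega (H m) = 0 := by
  simp [omega, H, Module.Basis.constr_basis]

theorem omega_c : omega c = 0 := by
  simp [omega, c, Module.Basis.constr_basis]

end W22

/-! If every derivation is inner, a biderivation `f` is inner in each slot:
$f(x,y)=[\varphi(x),y]=[\psi(y),x]$, with $\varphi(x),\psi(y)$ determined modulo the center.
Comparing coefficients in $[L_n,\varphi(L_m)]=[L_m,\psi(L_n)]$ (`coeff_of_swap`) kills every degree
shift and leaves $\varphi(L_m)\equiv\lambda L_m+\mu H_m$; pairing $H_m$ with the $L_n$ then forces
$\varphi(H_m)\equiv\lambda H_m$. Innerness of derivations (`exists_eq_lie_of_derivation`): an inner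
derivation matches $D$ on all $L_n$ modulo the center, and the difference vanishes. The center $c$,
shared by both brackets, is what excludes the derivation rescaling the $H_n$. The converse rests on
$[\omega x,y]=[x,\omega y]$ (`lie_omega`). -/

namespace W22

/-! ### Coordinates of the bracket -/

/-- The coefficient of `L_n`. -/
noncomputable def coordL (n : ℤ) : W22 →ₗ[ℂ] ℂ := basis.coord (.L n)

/-- The coefficient of `H_n`. -/
noncomputable def coordH (n : ℤ) : W22 →ₗ[ℂ] ℂ := basis.coord (.H n)

/-- The coefficient of `c`. -/
noncomputable def coordC : W22 →ₗ[ℂ] ℂ := basis.coord .c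

theorem coordL_L (n m : ℤ) : coordL n (L m) = if m = n then 1 else 0 := by
  classical simp [coordL, L, Finsupp.single_apply]

theorem coordL_H (n m : ℤ) : coordL n (H m) = 0 := by
  simp [coordL, H]

theorem coordL_c (n : ℤ) : coordL n c = 0 := by
  simp [coordL, c]

theorem coordH_L (n m : ℤ) : coordH n (L m) = 0 := by
  simp [coordH, L]

theorem coordH_H (n m : ℤ) : coordH n (H m) = if m = n then 1 else 0 := by
  classical simp [coordH, H, Finsupp.single_apply]

theorem coordH_c (n : ℤ) : coordH n c = 0 := by
  simp [coordH, c]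

theorem coordC_L (m : ℤ) : coordC (L m) = 0 := by
  simp [coordC, L]

theorem coordC_H (m : ℤ) : coordC (H m) = 0 := by
  simp [coordC, H]

theorem coordC_c : coordC c = 1 := by
  simp [coordC, c]

theorem ext_coord {x y : W22} (hL : ∀ n, coordL n x = coordL n y)
    (hH : ∀ n, coordH n x = coordH n y) (hc : coordC x = coordC y) : x = y := by
  refine basis.ext_elem fun i => ?_
  cases i with
  | L n => exact hL n
  | H n => exact hH n
  | c => exact hc

theorem linearMap_ext {M : Type*} [AddCommGroup M] [Module ℂ M] {f g : W22 →ₗ[ℂ] M}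
    (hL : ∀ n, f (L n) = g (L n)) (hH : ∀ n, f (H n) = g (H n)) (hc : f c = g c) : f = g := by
  refine basis.ext fun i => ?_
  cases i with
  | L n => exact hL n
  | H n => exact hH n
  | c => exact hc

theorem lie_H_L (m n : ℤ) : ⁅H m, L n⁆ =
    ((m : ℂ) - n) • H (m + n) + cocycle m n • c := by
  rw [← lie_skew, lie_L_H, ← cocycle, cocycle_swap, add_comm n m]
  module

theorem c_lie (x : W22) : ⁅c, x⁆ = 0 := by
  rw [← lie_skew, lie_c, neg_zero]

theorem coordL_L_lie (m n : ℤ) (x : W22) :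
    coordL n ⁅L m, x⁆ = (2 * m - n) * coordL (n - m) x := by
  have h : coordL n ∘ₗ bracket (L m) = ((2 * m - n : ℂ)) • coordL (n - m) := by
    refine linearMap_ext (fun k => ?_) (fun k => ?_) ?_
    · change coordL n ⁅L m, L k⁆ = _ * coordL (n - m) (L k)
      rw [lie_L_L, map_add, map_smul, map_smul, coordL_L, coordL_L, coordL_c]
      by_cases hk : m + k = n
      · subst hk
        simp
        ring
      · have hk' : k ≠ n - m := by omega
        simp [hk, hk']
    · change coordL n ⁅L m, H k⁆ = _ * coordL (n - m) (H k)
      rw [lie_L_H, map_add, map_smul, map_smul, coordL_H, coordL_H, coordL_c]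
      simp
    · change coordL n ⁅L m, c⁆ = _ * coordL (n - m) c
      rw [lie_c, coordL_c]
      simp
  exact LinearMap.congr_fun h x

theorem coordH_L_lie (m n : ℤ) (x : W22) :
    coordH n ⁅L m, x⁆ = (2 * m - n) * coordH (n - m) x := by
  have h : coordH n ∘ₗ bracket (L m) = ((2 * m - n : ℂ)) • coordH (n - m) := by
    refine linearMap_ext (fun k => ?_) (fun k => ?_) ?_
    · change coordH n ⁅L m, L k⁆ = _ * coordH (n - m) (L k)
      rw [lie_L_L, map_add, map_smul, map_smul, coordH_L, coordH_L, coordH_c]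
      simp
    · change coordH n ⁅L m, H k⁆ = _ * coordH (n - m) (H k)
      rw [lie_L_H, map_add, map_smul, map_smul, coordH_H, coordH_H, coordH_c]
      by_cases hk : m + k = n
      · subst hk
        simp
        ring
      · have hk' : k ≠ n - m := by omega
        simp [hk, hk']
    · change coordH n ⁅L m, c⁆ = _ * coordH (n - m) c
      rw [lie_c, coordH_c]
      simp
  exact LinearMap.congr_fun h x

theorem coordC_L_lie (m : ℤ) (x : W22) :
    coordC ⁅L m, x⁆ = ((m : ℂ) ^ 3 - m) / 12 * (coordL (-m) x + coordH (-m) x) := by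
  have h : coordC ∘ₗ bracket (L m) =
      (((m : ℂ) ^ 3 - m) / 12) • (coordL (-m) + coordH (-m)) := by
    refine linearMap_ext (fun k => ?_) (fun k => ?_) ?_
    · change coordC ⁅L m, L k⁆ = _ * (coordL (-m) (L k) + coordH (-m) (L k))
      rw [lie_L_L, map_add, map_smul, map_smul, coordC_L, coordC_c, coordL_L, coordH_L]
      by_cases hk : m + k = 0
      · have hk' : k = -m := by omega
        simp [hk']
      · have hk' : k ≠ -m := by omega
        simp [hk, hk']
    · change coordC ⁅L m, H k⁆ = _ * (coordL (-m) (H k) + coordH (-m) (H k))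
      rw [lie_L_H, map_add, map_smul, map_smul, coordC_H, coordC_c, coordL_H, coordH_H]
      by_cases hk : m + k = 0
      · have hk' : k = -m := by omega
        simp [hk']
      · have hk' : k ≠ -m := by omega
        simp [hk, hk']
    · change coordC ⁅L m, c⁆ = _ * (coordL (-m) c + coordH (-m) c)
      rw [lie_c, coordL_c, coordH_c]
      simp
  exact LinearMap.congr_fun h x

theorem coordL_H_lie (m n : ℤ) (x : W22) : coordL n ⁅H m, x⁆ = 0 := by
  have h : coordL n ∘ₗ bracket (H m) = 0 := by
    refine linearMap_ext (fun k => ?_) (fun k => ?_) ?_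
    · change coordL n ⁅H m, L k⁆ = 0
      rw [lie_H_L, map_add, map_smul, map_smul, coordL_H, coordL_c]
      simp
    · change coordL n ⁅H m, H k⁆ = 0
      rw [lie_H_H, map_zero]
    · change coordL n ⁅H m, c⁆ = 0
      rw [lie_c, map_zero]
  exact LinearMap.congr_fun h x

theorem coordH_H_lie (m n : ℤ) (x : W22) :
    coordH n ⁅H m, x⁆ = (2 * m - n) * coordL (n - m) x := by
  have h : coordH n ∘ₗ bracket (H m) = ((2 * m - n : ℂ)) • coordL (n - m) := by
    refine linearMap_ext (fun k => ?_) (fun k => ?_) ?_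
    · change coordH n ⁅H m, L k⁆ = _ * coordL (n - m) (L k)
      rw [lie_H_L, map_add, map_smul, map_smul, coordH_H, coordL_L, coordH_c]
      by_cases hk : m + k = n
      · subst hk
        simp
        ring
      · have hk' : k ≠ n - m := by omega
        simp [hk, hk']
    · change coordH n ⁅H m, H k⁆ = _ * coordL (n - m) (H k)
      rw [lie_H_H, coordL_H]
      simp
    · change coordH n ⁅H m, c⁆ = _ * coordL (n - m) c
      rw [lie_c, coordL_c]
      simp
  exact LinearMap.congr_fun h x

theorem eq_smul_c {x : W22} (hL : ∀ n, coordL n x = 0) (hH : ∀ n, coordH n x = 0) :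
    x = coordC x • c := by
  refine ext_coord (fun n => ?_) (fun n => ?_) ?_
  · rw [map_smul, coordL_c, hL, smul_zero]
  · rw [map_smul, coordH_c, hH, smul_zero]
  · rw [map_smul, coordC_c, smul_eq_mul, mul_one]

theorem lie_eq_zero_of_coord {x : W22} (hL : ∀ n, coordL n x = 0) (hH : ∀ n, coordH n x = 0)
    (y : W22) : ⁅y, x⁆ = 0 := by
  rw [eq_smul_c hL hH, lie_smul, lie_c, smul_zero]

/-! ### Recurrences for coefficients by degree shift -/

/-- An additive-up-to-the-diagonal function on `ℤ` is linear. -/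
theorem eq_mul_of_add_off_diagonal {a : ℤ → ℂ}
    (h : ∀ m n : ℤ, m ≠ n → a (m + n) = a m + a n) (n : ℤ) : a n = n * a 1 := by
  have h0 : a 0 = 0 := by simpa using h 1 0 (by norm_num)
  have h2 : a 2 = 2 * a 1 := by
    -- The pair $(1,1)$ is excluded, so $5=4+1=3+2$ and $4=3+1$ replace it.
    have e1 := h 4 1 (by norm_num)
    have e2 := h 3 2 (by norm_num)
    have e3 := h 3 1 (by norm_num)
    norm_num at e1 e2 e3
    linear_combination e1 - e2 + e3
  have hn : ∀ k : ℕ, a k = k * a 1 := by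
    intro k
    induction k with
    | zero => simpa using h0
    | succ k ih =>
      by_cases hk : k = 1
      · subst hk
        norm_num
        exact h2
      · have := h k 1 (by exact_mod_cast hk)
        push_cast
        rw [this, ih]
        ring
  rcases Int.eq_nat_or_neg n with ⟨k, rfl | rfl⟩
  · simpa using hn k
  · by_cases hk : k = 0
    · subst hk
      simpa using h0
    · have := h k (-k) (by omega)
      rw [add_neg_cancel, h0, hn k] at this
      push_cast
      linear_combination -this

/-- Coefficients of a derivation on the Virasoro part: the shift by `k` is that of an inner one. -/
theorem coeff_of_derivation {a : ℤ → ℤ → ℂ}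
    (h : ∀ m n k : ℤ, ((m : ℂ) - n) * a (m + n) k =
      (m - n - k) * a n k + (m + k - n) * a m k) (n k : ℤ) :
    a n k = (k - n) * ((k : ℂ)⁻¹ * a 0 k - if k = 0 then a 1 0 else 0) := by
  -- For $k=0$ the recurrence is additivity off the diagonal; for $k\ne0$, bracketing with $L_0$
  -- determines everything. The convention $0^{-1}=0$ merges the two formulas.
  by_cases hk : k = 0
  · subst hk
    have := eq_mul_of_add_off_diagonal (a := fun n => a n 0) (fun m n hmn => by
      have hmn' : (m : ℂ) - n ≠ 0 := sub_ne_zero.mpr (by exact_mod_cast hmn)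
      apply mul_left_cancel₀ hmn'
      have := h m n 0
      push_cast at this
      linear_combination this) n
    beta_reduce at this
    simp [this]
  · have hk' : (k : ℂ) ≠ 0 := by exact_mod_cast hk
    have := h n 0 k
    rw [add_zero] at this
    push_cast at this
    simp only [hk, if_false]
    field_simp
    linear_combination -this

/-- The partial inverse of the adjoint action of `-L_0`. -/
noncomputable def invDegree : W22 →ₗ[ℂ] W22 :=
  basis.constr ℂ fun i => match i with
    | .L m => (m : ℂ)⁻¹ • L m
    | .H m => (m : ℂ)⁻¹ • H m
    | .c => 0

theorem invDegree_L (m : ℤ) : invDegree (L m) = (m : ℂ)⁻¹ • L m := by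
  conv_lhs => rw [L, invDegree, Module.Basis.constr_basis]

theorem invDegree_H (m : ℤ) : invDegree (H m) = (m : ℂ)⁻¹ • H m := by
  conv_lhs => rw [H, invDegree, Module.Basis.constr_basis]

theorem invDegree_c : invDegree c = 0 := by
  rw [c, invDegree, Module.Basis.constr_basis]

theorem coordL_invDegree (n : ℤ) (x : W22) :
    coordL n (invDegree x) = (n : ℂ)⁻¹ * coordL n x := by
  have h : coordL n ∘ₗ invDegree = ((n : ℂ)⁻¹) • coordL n := by
    refine linearMap_ext (fun k => ?_) (fun k => ?_) ?_
    · simp only [LinearMap.comp_apply, LinearMap.smul_apply, invDegree_L, map_smul, coordL_L]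
      split_ifs with hk <;> simp [*]
    · simp [invDegree_H, coordL_H]
    · simp [invDegree_c, coordL_c]
  exact LinearMap.congr_fun h x

theorem coordH_invDegree (n : ℤ) (x : W22) :
    coordH n (invDegree x) = (n : ℂ)⁻¹ * coordH n x := by
  have h : coordH n ∘ₗ invDegree = ((n : ℂ)⁻¹) • coordH n := by
    refine linearMap_ext (fun k => ?_) (fun k => ?_) ?_
    · simp [invDegree_L, coordH_L]
    · simp only [LinearMap.comp_apply, LinearMap.smul_apply, invDegree_H, map_smul, coordH_H]
      split_ifs with hk <;> simp [*]
    · simp [invDegree_c, coordH_c]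
  exact LinearMap.congr_fun h x

/-! ### Derivations are inner -/

section Derivation

variable {D : W22 →ₗ[ℂ] W22}

theorem coordL_derivation_c (hD : ∀ x y : W22, D ⁅x, y⁆ = ⁅D x, y⁆ + ⁅x, D y⁆) (n : ℤ) :
    coordL n (D c) = 0 := by
  have h (m : ℤ) : ⁅L m, D c⁆ = 0 := by
    have := hD (L m) c
    rwa [lie_c, lie_c, map_zero, zero_add, eq_comm] at this
  -- The index $n+1$ makes the structure constant $2(n+1)-(2n+1)=1$.
  have := congrArg (coordL (n + (n + 1))) (h (n + 1))
  rw [coordL_L_lie, map_zero, add_sub_cancel_right] at this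
  push_cast at this
  linear_combination this

theorem coordH_derivation_c (hD : ∀ x y : W22, D ⁅x, y⁆ = ⁅D x, y⁆ + ⁅x, D y⁆) (n : ℤ) :
    coordH n (D c) = 0 := by
  have h (m : ℤ) : ⁅L m, D c⁆ = 0 := by
    have := hD (L m) c
    rwa [lie_c, lie_c, map_zero, zero_add, eq_comm] at this
  have := congrArg (coordH (n + (n + 1))) (h (n + 1))
  rw [coordH_L_lie, map_zero, add_sub_cancel_right] at this
  push_cast at this
  linear_combination this

theorem derivation_L_L (hD : ∀ x y : W22, D ⁅x, y⁆ = ⁅D x, y⁆ + ⁅x, D y⁆) (m n : ℤ) :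
    ((m : ℂ) - n) • D (L (m + n)) + cocycle m n • D c = ⁅L m, D (L n)⁆ - ⁅L n, D (L m)⁆ := by
  have := hD (L m) (L n)
  rw [lie_L_L, map_add, map_smul, map_smul] at this
  rw [cocycle, this, ← lie_skew (D (L m))]
  abel

/-- Modulo the center, a derivation agrees with an inner one on the Virasoro part. -/
theorem exists_coord_derivation (hD : ∀ x y : W22, D ⁅x, y⁆ = ⁅D x, y⁆ + ⁅x, D y⁆) :
    ∃ u : W22, ∀ n k : ℤ, coordL k (D (L n) - ⁅u, L n⁆) = 0 ∧
      coordH k (D (L n) - ⁅u, L n⁆) = 0 := by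
  have ha := coeff_of_derivation (a := fun n k => coordL (n + k) (D (L n))) (fun m n k => by
    have := congrArg (coordL (m + n + k)) (derivation_L_L hD m n)
    rw [map_add, map_sub, map_smul, map_smul, coordL_derivation_c hD, coordL_L_lie,
      coordL_L_lie, show m + n + k - m = n + k by ring, show m + n + k - n = m + k by ring] at this
    simp only [smul_eq_mul] at this
    push_cast at this
    linear_combination this)
  have hb := coeff_of_derivation (a := fun n k => coordH (n + k) (D (L n))) (fun m n k => by
    have := congrArg (coordH (m + n + k)) (derivation_L_L hD m n)
    rw [map_add, map_sub, map_smul, map_smul, coordH_derivation_c hD, coordH_L_lie,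
      coordH_L_lie, show m + n + k - m = n + k by ring, show m + n + k - n = m + k by ring] at this
    simp only [smul_eq_mul] at this
    push_cast at this
    linear_combination this)
  -- The nonzero degrees of `u` are read off $D(L_0)$; its degree $0$ part, invisible there, comes
  -- from $D(L_1)$.
  refine ⟨invDegree (D (L 0)) - coordL (1 + 0) (D (L 1)) • L 0 -
    coordH (1 + 0) (D (L 1)) • H 0, fun n k => ⟨?_, ?_⟩⟩
  · have := ha n (k - n)
    beta_reduce at this
    rw [add_sub_cancel, zero_add] at this
    rw [← lie_skew, sub_neg_eq_add, map_add, coordL_L_lie, this, map_sub, map_sub, map_smul,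
      map_smul, coordL_invDegree, coordL_L, coordL_H]
    simp only [eq_comm (a := (0 : ℤ)) (b := k - n), smul_eq_mul, mul_ite, mul_one, mul_zero]
    push_cast
    ring
  · have := hb n (k - n)
    beta_reduce at this
    rw [add_sub_cancel, zero_add] at this
    rw [← lie_skew, sub_neg_eq_add, map_add, coordH_L_lie, this, map_sub, map_sub, map_smul,
      map_smul, coordH_invDegree, coordH_L, coordH_H]
    simp only [eq_comm (a := (0 : ℤ)) (b := k - n), smul_eq_mul, mul_ite, mul_one, mul_zero]
    push_cast
    ring

/-- A derivation sending each `L_n` to the center kills all `L_n` and `c`. -/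
theorem derivation_L_eq_zero (hD : ∀ x y : W22, D ⁅x, y⁆ = ⁅D x, y⁆ + ⁅x, D y⁆)
    (hL : ∀ n k : ℤ, coordL k (D (L n)) = 0 ∧ coordH k (D (L n)) = 0) :
    (∀ n, D (L n) = 0) ∧ D c = 0 := by
  have h (m n : ℤ) : ((m : ℂ) - n) • D (L (m + n)) + cocycle m n • D c = 0 := by
    rw [derivation_L_L hD, lie_eq_zero_of_coord (fun k => (hL n k).1) (fun k => (hL n k).2),
      lie_eq_zero_of_coord (fun k => (hL m k).1) (fun k => (hL m k).2), sub_zero]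
  have h0 : D (L 0) = 0 := by
    -- The cocycle vanishes at $(1,-1)$, isolating $D(L_0)$; at $(2,-2)$ it is $1/2$, which later
    -- gives $D(c)=0$.
    have := h 1 (-1)
    norm_num [cocycle] at this
    exact this
  refine ⟨fun n => ?_, ?_⟩
  · by_cases hn : n = 0
    · rw [hn, h0]
    · have := h n 0
      simpa [cocycle, hn] using this
  · have := h 2 (-2)
    norm_num [cocycle, h0] at this
    exact this

/-- A derivation vanishing on all `L_n` and on `c` vanishes on all `H_n`. -/
theorem derivation_H_eq_zero (hD : ∀ x y : W22, D ⁅x, y⁆ = ⁅D x, y⁆ + ⁅x, D y⁆)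
    (hL : ∀ n, D (L n) = 0) (hc : D c = 0) (n : ℤ) : D (H n) = 0 := by
  have h (m n : ℤ) : ((m : ℂ) - n) • D (H (m + n)) = ⁅L m, D (H n)⁆ := by
    have := hD (L m) (H n)
    rwa [lie_L_H, map_add, map_smul, map_smul, hL, hc, smul_zero, add_zero, zero_lie,
      zero_add] at this
  -- Taking $m=n$ kills nonzero shifts; taking $n=k=0$ makes the zero shift constant. So
  -- $D(H_n)\equiv pL_n+qH_n$ modulo the center.
  have key {a : ℤ → ℤ → ℂ} (ha : ∀ m n k : ℤ,
      ((m : ℂ) - n) * a (m + n) k = (m - n - k) * a n k) :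
      (∀ n k, k ≠ 0 → a n k = 0) ∧ ∀ n, a n 0 = a 0 0 := by
    refine ⟨fun n k hk => ?_, fun n => ?_⟩
    · have hk' : (k : ℂ) ≠ 0 := by exact_mod_cast hk
      have := ha n n k
      apply mul_left_cancel₀ hk'
      linear_combination this
    · by_cases hn : n = 0
      · rw [hn]
      · have hn' : (n : ℂ) ≠ 0 := by exact_mod_cast hn
        have := ha n 0 0
        rw [add_zero] at this
        push_cast at this
        apply mul_left_cancel₀ hn'
        linear_combination this
  obtain ⟨hp, hp0⟩ := key (a := fun n k => coordL (n + k) (D (H n))) (fun m n k => by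
    have := congrArg (coordL (m + n + k)) (h m n)
    rw [map_smul, coordL_L_lie, show m + n + k - m = n + k by ring, smul_eq_mul] at this
    rw [this]
    push_cast
    ring)
  obtain ⟨hq, hq0⟩ := key (a := fun n k => coordH (n + k) (D (H n))) (fun m n k => by
    have := congrArg (coordH (m + n + k)) (h m n)
    rw [map_smul, coordH_L_lie, show m + n + k - m = n + k by ring, smul_eq_mul] at this
    rw [this]
    push_cast
    ring)
  simp only [add_zero] at hp0 hq0
  have he (m n : ℤ) := congrArg coordC (h m n)
  simp only [map_smul, coordC_L_lie, smul_eq_mul] at he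
  have hC0 : coordC (D (H 0)) = 0 := by
    have := he 1 (-1)
    norm_num at this
    exact this
  -- The central term of $[L_2,D(H_{-2})]$ is $(p+q)/2$, as both brackets share $c$.
  have hpq : coordL 0 (D (H 0)) + coordH 0 (D (H 0)) = 0 := by
    have := he 2 (-2)
    rw [hp0 (-2), hq0 (-2)] at this
    norm_num [hC0] at this
    exact this
  -- Differentiating $[H_1,H_0]=0$ gives $2p=0$ in the coefficient of $H_1$.
  have hpz : coordL 0 (D (H 0)) = 0 := by
    have := congrArg (coordH 1) (hD (H 1) (H 0))
    rw [lie_H_H, map_zero, map_zero, ← lie_skew (D (H 1)), map_add, map_neg, coordH_H_lie,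
      coordH_H_lie] at this
    have h1 := hp0 1
    norm_num at this
    rw [h1] at this
    linear_combination -(1 / 2) * this
  have hqz : coordH 0 (D (H 0)) = 0 := by simpa [hpz] using hpq
  refine ext_coord (fun k => ?_) (fun k => ?_) ?_
  · rw [map_zero]
    by_cases hk : k = n
    · rw [hk, hp0, hpz]
    · simpa using hp n (k - n) (sub_ne_zero.mpr hk)
  · rw [map_zero]
    by_cases hk : k = n
    · rw [hk, hq0, hqz]
    · simpa using hq n (k - n) (sub_ne_zero.mpr hk)
  · rw [map_zero]
    by_cases hn : n = 0
    · rw [hn, hC0]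
    · simpa [hn] using he 0 n

/-- Every derivation of `W(2,2)` is inner. -/
theorem exists_eq_lie_of_derivation (hD : ∀ x y : W22, D ⁅x, y⁆ = ⁅D x, y⁆ + ⁅x, D y⁆) :
    ∃ u : W22, ∀ x, D x = ⁅u, x⁆ := by
  obtain ⟨u, hu⟩ := exists_coord_derivation hD
  refine ⟨u, ?_⟩
  have hE : ∀ x y : W22, (D - bracket u) ⁅x, y⁆ =
      ⁅(D - bracket u) x, y⁆ + ⁅x, (D - bracket u) y⁆ := by
    intro x y
    change D ⁅x, y⁆ - ⁅u, ⁅x, y⁆⁆ = ⁅D x - ⁅u, x⁆, y⁆ + ⁅x, D y - ⁅u, y⁆⁆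
    rw [hD, leibniz_lie, sub_lie, lie_sub]
    abel
  obtain ⟨hL, hc⟩ := derivation_L_eq_zero hE hu
  have h0 : D - bracket u = 0 := linearMap_ext hL (derivation_H_eq_zero hE hL hc) hc
  intro x
  exact sub_eq_zero.mp (LinearMap.congr_fun h0 x)

end Derivation

/-! ### The family of biderivations -/

/-- $[H_m,L_n]$ and $[L_m,H_n]$ have equal structure constants. The stronger $\omega[x,y]=[\omega
x,y]$ fails, since $\omega$ kills the central term. -/
theorem lie_omega (x y : W22) : ⁅omega x, y⁆ = ⁅x, omega y⁆ := by
  have h : bracket ∘ₗ omega = bracket.compl₂ omega := by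
    refine linearMap_ext (fun m => ?_) (fun m => ?_) ?_ <;>
      refine linearMap_ext (fun n => ?_) (fun n => ?_) ?_
    · change ⁅omega (L m), L n⁆ = ⁅L m, omega (L n)⁆
      rw [omega_L, omega_L, lie_H_L, lie_L_H, cocycle]
    · change ⁅omega (L m), H n⁆ = ⁅L m, omega (H n)⁆
      rw [omega_L, omega_H, lie_H_H, lie_zero]
    · change ⁅omega (L m), c⁆ = ⁅L m, omega c⁆
      rw [omega_c, lie_c, lie_zero]
    · change ⁅omega (H m), L n⁆ = ⁅H m, omega (L n)⁆
      rw [omega_L, omega_H, lie_H_H, zero_lie]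
    · change ⁅omega (H m), H n⁆ = ⁅H m, omega (H n)⁆
      rw [omega_H, omega_H, lie_zero, zero_lie]
    · change ⁅omega (H m), c⁆ = ⁅H m, omega c⁆
      rw [omega_c, lie_c, lie_zero]
    · change ⁅omega c, L n⁆ = ⁅c, omega (L n)⁆
      rw [omega_c, c_lie, zero_lie]
    · change ⁅omega c, H n⁆ = ⁅c, omega (H n)⁆
      rw [omega_c, c_lie, zero_lie]
    · change ⁅omega c, c⁆ = ⁅c, omega c⁆
      rw [omega_c, lie_zero, zero_lie]
  exact LinearMap.congr_fun (LinearMap.congr_fun h x) y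

theorem isBiderivation_of_eq {f : W22 →ₗ[ℂ] W22 →ₗ[ℂ] W22} {lam mu : ℂ}
    (h : ∀ x y : W22, f x y = lam • ⁅x, y⁆ + mu • ⁅omega x, y⁆) : IsBiderivation f := by
  refine ⟨fun x y z => ?_, fun x y z => ?_⟩
  · have key (w : W22) : ⁅⁅x, y⁆, w⁆ = ⁅x, ⁅y, w⁆⁆ + ⁅⁅x, w⁆, y⁆ := by
      rw [lie_lie, ← lie_skew y ⁅x, w⁆]
      abel
    -- With $\omega$ moved to the last argument, the first-slot identity is Jacobi for $z$ and for
    -- $\omega(z)$.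
    simp only [h, lie_omega, lie_add, add_lie, lie_smul, smul_lie]
    rw [key z, key (omega z)]
    module
  · simp only [h, lie_add, add_lie, lie_smul, smul_lie, leibniz_lie _ y z]
    module

/-! ### Classification of biderivations -/

/-- Coefficients of maps `φ`, `ψ` with `[φ x, y] = [ψ y, x]` on the Virasoro part. -/
theorem coeff_of_swap {a g : ℤ → ℤ → ℂ}
    (h : ∀ m n k : ℤ, ((n : ℂ) - m - k) * a m k = (m - n - k) * g n k) :
    ∀ n k, a n k = (if k = 0 then a 0 0 else 0) ∧ g n k = -(if k = 0 then a 0 0 else 0) := by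
  have ha (m k : ℤ) (hk : k ≠ 0) : a m k = 0 := by
    have hk' : (k : ℂ) ≠ 0 := by exact_mod_cast hk
    -- This index kills the right side and leaves $-2k\,a_{m,k}=0$.
    have := h m (m - k) k
    push_cast at this
    apply mul_left_cancel₀ hk'
    linear_combination -(1 / 2) * this
  have hg (n k : ℤ) (hk : k ≠ 0) : g n k = 0 := by
    have hk' : (k : ℂ) ≠ 0 := by exact_mod_cast hk
    have := h (n - k) n k
    push_cast at this
    apply mul_left_cancel₀ hk'
    linear_combination (1 / 2) * this
  have hag (m n : ℤ) (hmn : m ≠ n) : g n 0 = -a m 0 := by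
    have hmn' : (m : ℂ) - n ≠ 0 := sub_ne_zero.mpr (by exact_mod_cast hmn)
    have := h m n 0
    push_cast at this
    apply mul_left_cancel₀ hmn'
    linear_combination -this
  have ha0 (m : ℤ) : a m 0 = a 0 0 := by
    -- $|m|+1$ differs from both $m$ and $0$.
    have h1 := hag m (|m| + 1) (by have := le_abs_self m; omega)
    have h2 := hag 0 (|m| + 1) (by have := abs_nonneg m; omega)
    linear_combination h1 - h2
  intro n k
  by_cases hk : k = 0
  · subst hk
    simp only [if_true]
    exact ⟨ha0 n, by rw [hag (n + 1) n (by omega), ha0]⟩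
  · simp [hk, ha n k hk, hg n k hk]

theorem exists_eq_of_isBiderivation {f : W22 →ₗ[ℂ] W22 →ₗ[ℂ] W22} (hf : IsBiderivation f) :
    ∃ lam mu : ℂ, ∀ x y : W22, f x y = lam • ⁅x, y⁆ + mu • ⁅omega x, y⁆ := by
  have hφ (x : W22) : ∃ u : W22, ∀ y, f x y = ⁅u, y⁆ :=
    exists_eq_lie_of_derivation (hf.2 x)
  have hψ (y : W22) : ∃ u : W22, ∀ x, f x y = ⁅u, x⁆ :=
    exists_eq_lie_of_derivation (D := f.flip y) fun x z => by
      simp only [LinearMap.flip_apply]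
      rw [hf.1, add_comm]
  choose φ hφ using hφ
  choose ψ hψ using hψ
  have hφψ (x y : W22) : ⁅y, φ x⁆ = ⁅x, ψ y⁆ := by
    rw [← lie_skew, ← hφ, hψ, lie_skew]
  have ha := coeff_of_swap (a := fun m k => coordL (m + k) (φ (L m)))
    (g := fun m k => coordL (m + k) (ψ (L m))) (fun m n k => by
      have := congrArg (coordL (m + n + k)) (hφψ (L m) (L n))
      rw [coordL_L_lie, coordL_L_lie, show m + n + k - m = n + k by ring,
        show m + n + k - n = m + k by ring] at this
      push_cast at this
      linear_combination this)
  have hb := coeff_of_swap (a := fun m k => coordH (m + k) (φ (L m)))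
    (g := fun m k => coordH (m + k) (ψ (L m))) (fun m n k => by
      have := congrArg (coordH (m + n + k)) (hφψ (L m) (L n))
      rw [coordH_L_lie, coordH_L_lie, show m + n + k - m = n + k by ring,
        show m + n + k - n = m + k by ring] at this
      push_cast at this
      linear_combination this)
  beta_reduce at ha hb
  set lam := coordL (0 + 0) (φ (L 0))
  set mu := coordH (0 + 0) (φ (L 0))
  -- `φ` is merely chosen, not known to be linear; its $L$ and $H$ coordinates suffice to recover `f
  -- x`.
  have eqn {x u : W22} (hL : ∀ k, coordL k (φ x) = coordL k u)
      (hH : ∀ k, coordH k (φ x) = coordH k u) (y : W22) : f x y = ⁅u, y⁆ := by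
    rw [hφ, ← sub_eq_zero, ← sub_lie, ← lie_skew, neg_eq_zero]
    exact lie_eq_zero_of_coord (fun k => by rw [map_sub, hL, sub_self])
      (fun k => by rw [map_sub, hH, sub_self]) y
  have hpL (m k : ℤ) : coordL k (φ (H m)) = 0 := by
    have := congrArg (coordL (k + (k + 1))) (hφψ (H m) (L (k + 1)))
    rw [coordL_L_lie, coordL_H_lie, add_sub_cancel_right] at this
    push_cast at this
    linear_combination this
  have hpH (m k : ℤ) : coordH k (φ (H m)) = if m = k then lam else 0 := by
    have := congrArg (coordH (k + (k + 1))) (hφψ (H m) (L (k + 1)))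
    have h2 := (ha (k + 1) (k - m)).2
    rw [show k + 1 + (k - m) = k + (k + 1) - m by ring] at h2
    rw [coordH_L_lie, coordH_H_lie, add_sub_cancel_right, h2] at this
    by_cases hk : m = k
    · subst hk
      simp only [sub_self, if_true] at this ⊢
      push_cast at this
      linear_combination this
    · have hk' : k - m ≠ 0 := by omega
      simp only [hk, hk', if_false] at this ⊢
      push_cast at this
      linear_combination this
  refine ⟨lam, mu, fun x y => ?_⟩
  have key : f = lam • bracket + mu • (bracket ∘ₗ omega) := by
    refine linearMap_ext (fun m => ?_) (fun m => ?_) ?_ <;> refine LinearMap.ext fun y => ?_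
    · change f (L m) y = lam • ⁅L m, y⁆ + mu • ⁅omega (L m), y⁆
      rw [omega_L, ← smul_lie, ← smul_lie, ← add_lie]
      refine eqn (fun k => ?_) (fun k => ?_) y
      · have := (ha m (k - m)).1
        rw [add_sub_cancel] at this
        rw [this, map_add, map_smul, map_smul, coordL_L, coordL_H]
        simp [sub_eq_zero, eq_comm]
      · have := (hb m (k - m)).1
        rw [add_sub_cancel] at this
        rw [this, map_add, map_smul, map_smul, coordH_L, coordH_H]
        simp [sub_eq_zero, eq_comm]
    · change f (H m) y = lam • ⁅H m, y⁆ + mu • ⁅omega (H m), y⁆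
      rw [omega_H, zero_lie, smul_zero, add_zero, ← smul_lie]
      refine eqn (fun k => ?_) (fun k => ?_) y
      · rw [hpL, map_smul, coordL_H, smul_zero]
      · rw [hpH, map_smul, coordH_H]
        simp
    · change f c y = lam • ⁅c, y⁆ + mu • ⁅omega c, y⁆
      rw [omega_c, hψ, lie_c, c_lie, zero_lie, smul_zero, smul_zero, add_zero]
  exact LinearMap.congr_fun (LinearMap.congr_fun key x) y

theorem not_isInnerBiderivation_bracket_omega :
    ¬ IsInnerBiderivation (bracket ∘ₗ omega) := by
  rintro ⟨a, ha⟩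
  -- $[H_1,L_0]$ has an $H_1$ component, while $[L_1,L_0]$ has none.
  have h := congrArg (coordH 1) (ha (L 1) (L 0))
  change coordH 1 ⁅omega (L 1), L 0⁆ = coordH 1 (a • ⁅L 1, L 0⁆) at h
  rw [omega_L, coordH_H_lie, map_smul, coordH_L_lie, coordH_L, coordL_L] at h
  norm_num at h

end W22

theorem mainTheorem1 :
    (∀ f : W22 →ₗ[ℂ] W22 →ₗ[ℂ] W22,
      IsBiderivation f ↔
        ∃ lam mu : ℂ, ∀ x y : W22, f x y = lam • ⁅x, y⁆ + mu • ⁅W22.omega x, y⁆) ∧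
    (∃ f : W22 →ₗ[ℂ] W22 →ₗ[ℂ] W22, IsBiderivation f ∧ ¬ IsInnerBiderivation f) := by
  refine ⟨fun f => ⟨W22.exists_eq_of_isBiderivation, ?_⟩, W22.bracket ∘ₗ W22.omega, ?_,
    W22.not_isInnerBiderivation_bracket_omega⟩
  · rintro ⟨lam, mu, h⟩
    exact W22.isBiderivation_of_eq h
  · refine W22.isBiderivation_of_eq (lam := 0) (mu := 1) fun x y => ?_
    rw [zero_smul, one_smul, zero_add]
    rfl
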